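/- Let $d\ge 1$, let $K:\mathbb R^d\times\mathbb R^d\to\mathbb R^{d\times d}$ be the kernel of a reproducing kernel Hilbert space $H$ of functions $\mathbb R^d\to\mathbb R^d$, let $f_0\in H$, $T>0$, $R,r,M_\epsilon,N_K\ge 0$, and let $|\cdot|$ be the Euclidean norm. Let $0=t_1<\dots<t_m\le t_{m+1}:=T$ and $h>0$ be such that $t_j=k_jh$ with integers $k_j\ge 0$ for $1\le j\le m$. Assume: (A1) there are $f^*\in H$ with $\|f^*-f_0\|_H\le R$ and $x^*:[0,T]\to\mathbb R^d$ with $|x^*(0)|\le r$ and $\dot x^*(t)=f^*(x^*(t))$ for all $0\le t\le T$; (A2) $y_j=x^*(t_j)+\epsilon_j$ for $1\le j\le m$, where the $\epsilon_j$ are independent $\mathbb R^d$-valued random variables with mean zero and $|\epsilon_j|\le M_\epsilon$ almost surely; (A3) $K$ is $\mathcal C^2$ in its first argument; (A4) $K_{ii}(u,u)-2K_{ii}(u,v)+K_{ii}(v,v)\le N_K^2|u-v|^2$ for all $u,v\in\mathbb R^d$ and $1\le i\le d$. For $f\in H$ and $z_0\in\mathbb R^d$ let $z_{l+1}=z_l+hf(z_l)$,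 $l\ge 0$, be the Euler iterates. Let $(\hat f,\hat z_0)$ be a minimizer of $\sum_{j=1}^m(t_{j+1}-t_j)\,|y_j-z_{k_j}|^2$ over all $f\in H$ with $\|f-f_0\|_H\le R$ and all $z_0$ with $|z_0|\le r$, and let $\hat x$ be the function on $[0,T]$ obtained by linear interpolation of the Euler iterates of $(\hat f,\hat z_0)$ placed at the times $lh$. Put $\|\hat x-x^*\|_{L^2}^2=\int_0^T|\hat x(t)-x^*(t)|^2\,dt$. Then there are positive constants $K_1,K_2,K_3,K_4$, depending only on $R$, $r$, $T$, $M_\epsilon$, $N_K$, the kernel $K$ (hence on $d$) and an upper bound for $\|f_0\|_H$, such that for every $\epsilon>0$ the probability that $$\|\hat x-x^*\|_{L^2}^2\ \ge\ K_1d\sqrt{\sum_{j=1}^m(t_{j+1}-t_j)^2}+K_3dh^2+K_4d\sum_{j=1}^m(t_{j+1}-t_j)^2+\epsilon$$ is less than $$\exp\left(\frac{-K_2\epsilon^2}{d\sum_{j=1}^m(t_{j+1}-t_j)^2}\right).$$ -/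

import Mathlib

open MeasureTheory ProbabilityTheory

/-- The state space `ℝ^d` with its Euclidean norm. -/
abbrev Vec (d : ℕ) : Type := EuclideanSpace ℝ (Fin d)

/-- The diagonal entry `K_{ii}(u, v) = e_iᵀ K(u, v) e_i` of a matrix-valued kernel, whose values
are read as linear maps of `ℝ^d`. -/
noncomputable def kernelDiag {d : ℕ} (K : Matrix (Vec d) (Vec d) (Vec d →L[ℝ] Vec d))
    (i : Fin d) (u v : Vec d) : ℝ :=
  (K u v (EuclideanSpace.single i (1 : ℝ))) i

/-- The iterates `z_{l+1} = z_l + h f(z_l)` of Euler's method with step `h`, started at `z_0`. -/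
noncomputable def eulerNode {d : ℕ} (f : Vec d → Vec d) (h : ℝ) (z₀ : Vec d) : ℕ → Vec d
  | 0 => z₀
  | l + 1 => eulerNode f h z₀ l + h • f (eulerNode f h z₀ l)

/-- The Euler trajectory: linear interpolation of the nodes `z_l` placed at the times `s_l = l h`
(meant for `h > 0` and times `t ≥ 0`). -/
noncomputable def eulerPath {d : ℕ} (f : Vec d → Vec d) (h : ℝ) (z₀ : Vec d) (t : ℝ) : Vec d :=
  eulerNode f h z₀ ⌊t / h⌋₊ +
    ((t - ⌊t / h⌋₊ * h) / h) •
      (eulerNode f h z₀ (⌊t / h⌋₊ + 1) - eulerNode f h z₀ ⌊t / h⌋₊)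

/-- The sum of the squared gaps `∑_{j=1}^m (t_{j+1} - t_j)²`. -/
def sumSqGaps {m : ℕ} (t : Fin (m + 1) → ℝ) : ℝ :=
  ∑ j : Fin m, (t j.succ - t j.castSucc) ^ 2

/-- The weighted least squares loss `∑_{j=1}^m (t_{j+1} - t_j) |y_j - z_{k_j}|²` of the grid
function `z`. -/
noncomputable def lsLoss {d m : ℕ} (t : Fin (m + 1) → ℝ) (k : Fin m → ℕ) (y : Fin m → Vec d)
    (z : ℕ → Vec d) : ℝ :=
  ∑ j : Fin m, (t j.succ - t j.castSucc) * ‖y j - z (k j)‖ ^ 2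

/-- `(fhat, zhat)` solves the constrained least squares problem: it minimizes the loss of the Euler
iterates over all `f ∈ H` with `‖f - f₀‖_H ≤ R` and all initial states with `|z₀| ≤ r`. -/
structure IsLeastSquares {d m : ℕ} {H : Type*} [NormedAddCommGroup H] [InnerProductSpace ℝ H]
    [RKHS ℝ H (Vec d) (Vec d)] (f₀ : H) (R r h : ℝ) (t : Fin (m + 1) → ℝ) (k : Fin m → ℕ)
    (y : Fin m → Vec d) (fhat : H) (zhat : Vec d) : Prop where
  norm_sub_le : ‖fhat - f₀‖ ≤ R
  norm_init_le : ‖zhat‖ ≤ r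
  loss_le : ∀ (f : H) (z₀ : Vec d), ‖f - f₀‖ ≤ R → ‖z₀‖ ≤ r →
    lsLoss t k y (eulerNode fhat h zhat) ≤ lsLoss t k y (eulerNode f h z₀)

/-! By the reproducing property and (A4), all fields in the RKHS ball share a Lipschitz constant `L`
and a bound `A` at the origin. Gronwall estimates then confine the true trajectory and all Euler
iterates up to time `T` to radius `D`, with speed at most `Λ`. So the squared error is Lipschitz in
time, and its integral differs from the Riemann sum over observation times by a multiple of `∑
(t_{j+1} - t_j)²` (`integral_le_sum_add_sumSqGaps`).

The Riemann sum is compared with the Euler iterates of the true field, which are admissible.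
Minimality leaves their discretization error, of order `h²`, plus twice the pairing of the noise
with the difference of two Euler paths (`sum_sq_le_of_lsLoss_le`).

That difference depends on the noise, so a bound uniform over the class is needed. No entropy
argument is required: the difference starts in a ball and moves with speed at most `2Λ`, so
summation by parts (`sum_inner_le_tail_sums`) bounds the pairing by noise tail sums with
deterministic weights, whose total is independent of `m`. Each coordinate of a tail sum is
sub-Gaussian by Hoeffding's lemma, and Jensen's inequality for `exp` handles the weighted sum
without a union bound (`measureReal_le_sum_mul_abs_le`). -/

/-! ### Growth and speed of Euler paths -/

section Euler

variable {d : ℕ} {f : Vec d → Vec d} {L A T ρ h : ℝ} {z₀ : Vec d}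

lemma norm_le_affine_of_lipschitz (hL : ∀ u v, ‖f u - f v‖ ≤ L * ‖u - v‖) (hA : ‖f 0‖ ≤ A)
    (u : Vec d) : ‖f u‖ ≤ L * ‖u‖ + A := by
  have h1 := hL u 0
  rw [sub_zero] at h1
  have h2 := norm_le_insert' (f u) (f 0)
  linarith

lemma one_add_mul_pow_le_exp (hL : 0 ≤ L) (hh : 0 < h) {l : ℕ} (hl : l * h ≤ T) :
    (1 + h * L) ^ l ≤ Real.exp (L * T) := by
  calc (1 + h * L) ^ l ≤ Real.exp (h * L) ^ l := by
        gcongr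
        linarith [Real.add_one_le_exp (h * L)]
    _ = Real.exp (L * (l * h)) := by
        rw [← Real.exp_nat_mul]
        ring_nf
    _ ≤ Real.exp (L * T) := by gcongr

/-- For `1 ≤ L`, affine growth becomes linear in the shifted quantity `‖z‖ + A`, which each step
multiplies by at most `1 + h * L`. -/
lemma norm_eulerNode_add_le (h1 : 1 ≤ L) (hA : 0 ≤ A) (hf : ∀ u, ‖f u‖ ≤ L * ‖u‖ + A)
    (hh : 0 < h) (hz : ‖z₀‖ ≤ ρ) {l : ℕ} (hl : l * h ≤ T) :
    ‖eulerNode f h z₀ l‖ + A ≤ Real.exp (L * T) * (ρ + A) := by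
  have key : ∀ l : ℕ, ‖eulerNode f h z₀ l‖ + A ≤ (1 + h * L) ^ l * (ρ + A) := by
    intro l
    induction l with
    | zero => simpa [eulerNode] using hz
    | succ l ih =>
      have h2 : ‖eulerNode f h z₀ (l + 1)‖ ≤
          ‖eulerNode f h z₀ l‖ + h * (L * ‖eulerNode f h z₀ l‖ + A) := by
        rw [eulerNode]
        refine (norm_add_le _ _).trans ?_
        rw [norm_smul, Real.norm_of_nonneg hh.le]
        gcongr
        exact hf _
      have h3 : h * A ≤ h * L * A := by
        have : h * A * 1 ≤ h * A * L := by gcongr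
        linarith
      calc ‖eulerNode f h z₀ (l + 1)‖ + A ≤ (1 + h * L) * (‖eulerNode f h z₀ l‖ + A) := by linarith
        _ ≤ (1 + h * L) * ((1 + h * L) ^ l * (ρ + A)) := by gcongr
        _ = (1 + h * L) ^ (l + 1) * (ρ + A) := by ring
  refine (key l).trans ?_
  have : 0 ≤ ρ := (norm_nonneg _).trans hz
  gcongr
  exact one_add_mul_pow_le_exp (by linarith) hh hl

lemma norm_field_le_of_norm_add_le {D : ℝ} (h1 : 1 ≤ L) (hA : 0 ≤ A)
    (hf : ∀ u, ‖f u‖ ≤ L * ‖u‖ + A) {u : Vec d} (hu : ‖u‖ + A ≤ D) : ‖f u‖ ≤ L * D := by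
  have h2 : A * 1 ≤ A * L := by gcongr
  have h3 : L * (‖u‖ + A) ≤ L * D := by gcongr
  linarith [hf u]

lemma eulerPath_eq (hh : 0 < h) (s : ℝ) :
    eulerPath f h z₀ s = eulerNode f h z₀ ⌊s / h⌋₊ +
      (s - ⌊s / h⌋₊ * h) • f (eulerNode f h z₀ ⌊s / h⌋₊) := by
  rw [eulerPath, eulerNode, add_sub_cancel_left, smul_smul, div_mul_cancel₀ _ hh.ne']

lemma eulerPath_natCast_mul (hh : 0 < h) (l : ℕ) :
    eulerPath f h z₀ (l * h) = eulerNode f h z₀ l := by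
  rw [eulerPath_eq hh, mul_div_cancel_right₀ _ hh.ne', Nat.floor_natCast]
  simp

lemma floor_div_mul_le (hh : 0 < h) {s : ℝ} (hs : 0 ≤ s) : (⌊s / h⌋₊ : ℝ) * h ≤ s := by
  have := Nat.floor_le (div_nonneg hs hh.le)
  rwa [le_div_iff₀ hh] at this

lemma norm_eulerNode_sub_le {Λ : ℝ} (hh : 0 < h)
    (hΛ : ∀ l : ℕ, l * h ≤ T → ‖f (eulerNode f h z₀ l)‖ ≤ Λ) (a n : ℕ)
    (hn : ((a + n : ℕ) : ℝ) * h ≤ T) :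
    ‖eulerNode f h z₀ (a + n) - eulerNode f h z₀ a‖ ≤ Λ * (n * h) := by
  induction n with
  | zero => simp
  | succ n ih =>
    have h1 : ((a + n : ℕ) : ℝ) * h ≤ T := by
      refine le_trans ?_ hn
      gcongr
      omega
    have h2 : eulerNode f h z₀ (a + (n + 1)) - eulerNode f h z₀ a =
        (eulerNode f h z₀ (a + n) - eulerNode f h z₀ a) + h • f (eulerNode f h z₀ (a + n)) := by
      rw [← add_assoc, eulerNode]
      abel
    rw [h2]
    refine (norm_add_le _ _).trans ?_
    rw [norm_smul, Real.norm_of_nonneg hh.le]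
    have h3 := mul_le_mul_of_nonneg_left (hΛ _ h1) hh.le
    push_cast
    linarith [ih h1]

/-- The speed on a cell is the field at its left node, so only nodes at times up to `T` matter even
if the last cell extends past `T`. -/
lemma norm_eulerPath_sub_le {Λ : ℝ} (hh : 0 < h)
    (hΛ : ∀ l : ℕ, l * h ≤ T → ‖f (eulerNode f h z₀ l)‖ ≤ Λ) {s s' : ℝ} (hs : 0 ≤ s)
    (hss : s ≤ s') (hs' : s' ≤ T) :
    ‖eulerPath f h z₀ s' - eulerPath f h z₀ s‖ ≤ Λ * (s' - s) := by
  rw [eulerPath_eq hh, eulerPath_eq hh]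
  have e1 := floor_div_mul_le hh hs
  have e2 := floor_div_mul_le hh (hs.trans hss)
  have e3 := Nat.lt_floor_add_one (s / h)
  rw [div_lt_iff₀ hh] at e3
  have hle : ⌊s / h⌋₊ ≤ ⌊s' / h⌋₊ := Nat.floor_mono (by gcongr)
  generalize ⌊s / h⌋₊ = a at *
  generalize ⌊s' / h⌋₊ = b at *
  have ha := hΛ a (by linarith)
  have hb := hΛ b (by linarith)
  rcases hle.eq_or_lt with rfl | hlt
  · have h1 : eulerNode f h z₀ a + (s' - a * h) • f (eulerNode f h z₀ a) -
        (eulerNode f h z₀ a + (s - a * h) • f (eulerNode f h z₀ a)) =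
        (s' - s) • f (eulerNode f h z₀ a) := by
      module
    rw [h1, norm_smul, Real.norm_of_nonneg (by linarith), mul_comm]
    exact mul_le_mul_of_nonneg_right ha (by linarith)
  -- Different cells: the rest of the cell of `s`, then `n` full cells, then the start of the cell
  -- of `s'`.
  · obtain ⟨n, rfl⟩ := Nat.exists_eq_add_of_le (Nat.succ_le_of_lt hlt)
    have h1 := norm_eulerNode_sub_le hh hΛ (a + 1) n (by push_cast at e2 ⊢; linarith)
    have h2 : eulerNode f h z₀ (a + 1 + n) +
        (s' - ((a + 1 + n : ℕ) : ℝ) * h) • f (eulerNode f h z₀ (a + 1 + n)) -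
        (eulerNode f h z₀ a + (s - a * h) • f (eulerNode f h z₀ a)) =
        (eulerNode f h z₀ (a + 1 + n) - eulerNode f h z₀ (a + 1)) +
        (s' - ((a + 1 + n : ℕ) : ℝ) * h) • f (eulerNode f h z₀ (a + 1 + n)) +
        ((a + 1) * h - s) • f (eulerNode f h z₀ a) := by
      rw [eulerNode]
      module
    rw [Nat.succ_eq_add_one, h2]
    refine (norm_add₃_le).trans ?_
    rw [norm_smul, norm_smul, Real.norm_of_nonneg (by linarith), Real.norm_of_nonneg (by linarith)]
    have h3 := mul_le_mul_of_nonneg_left hb (sub_nonneg.2 e2)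
    have h4 := mul_le_mul_of_nonneg_left ha (sub_nonneg.2 e3.le)
    simp only [Nat.succ_eq_add_one] at *
    push_cast at *
    linarith

end Euler

/-! ### The exact flow and the global error of Euler's method -/

section Flow

variable {d : ℕ} {f : Vec d → Vec d} {L A T ρ h : ℝ} {x : ℝ → Vec d}

lemma norm_trajectory_add_le (h1 : 1 ≤ L) (hA : 0 ≤ A) (hf : ∀ u, ‖f u‖ ≤ L * ‖u‖ + A)
    (hx : ∀ s ∈ Set.Icc 0 T, HasDerivWithinAt x (f (x s)) (Set.Icc 0 T) s) (h0 : ‖x 0‖ ≤ ρ)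
    {s : ℝ} (hs : s ∈ Set.Icc 0 T) : ‖x s‖ + A ≤ Real.exp (L * T) * (ρ + A) := by
  have h2 := norm_le_gronwallBound_of_norm_deriv_right_le
    (fun s hs => (hx s hs).continuousWithinAt)
    (fun s hs => (hx s (Set.Ico_subset_Icc_self hs)).mono_of_mem_nhdsWithin
      (Icc_mem_nhdsGE_of_mem hs)) h0 (fun s _ => hf (x s)) s hs
  have hρ : 0 ≤ ρ := (norm_nonneg _).trans h0
  rw [gronwallBound_of_K_ne_0 (by linarith), sub_zero] at h2
  have h3 : Real.exp (L * s) ≤ Real.exp (L * T) := by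
    gcongr
    exact hs.2
  have h4 : 1 ≤ Real.exp (L * s) := Real.one_le_exp (mul_nonneg (by linarith) hs.1)
  have h5 : A / L ≤ A := div_le_self hA h1
  have h6 : A / L * (Real.exp (L * s) - 1) ≤ A * (Real.exp (L * s) - 1) := by
    gcongr
  have h7 : (ρ + A) * Real.exp (L * s) ≤ (ρ + A) * Real.exp (L * T) := by gcongr
  linarith

lemma norm_trajectory_sub_le {Λ : ℝ}
    (hx : ∀ s ∈ Set.Icc 0 T, HasDerivWithinAt x (f (x s)) (Set.Icc 0 T) s)
    (hΛ : ∀ s ∈ Set.Icc 0 T, ‖f (x s)‖ ≤ Λ) {s s' : ℝ} (hs : 0 ≤ s)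
    (hss : s ≤ s') (hs' : s' ≤ T) : ‖x s' - x s‖ ≤ Λ * (s' - s) := by
  have := (convex_Icc (0 : ℝ) T).norm_image_sub_le_of_norm_hasDerivWithin_le hx hΛ
    ⟨hs, hss.trans hs'⟩ ⟨hs.trans hss, hs'⟩
  rwa [Real.norm_of_nonneg (sub_nonneg.2 hss)] at this

/-- The curve `x s - s • f (x a)` has derivative `f (x s) - f (x a)`, of size at most `L * Λ * h` on
the step; no second derivative of `x` is needed. -/
lemma norm_trajectory_sub_eulerStep_le {Λ : ℝ} (hL0 : 0 ≤ L) (hΛ0 : 0 ≤ Λ)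
    (hL : ∀ u v, ‖f u - f v‖ ≤ L * ‖u - v‖)
    (hx : ∀ s ∈ Set.Icc 0 T, HasDerivWithinAt x (f (x s)) (Set.Icc 0 T) s)
    (hΛ : ∀ s ∈ Set.Icc 0 T, ‖f (x s)‖ ≤ Λ) (hh : 0 < h) {a : ℝ} (ha : 0 ≤ a)
    (hah : a + h ≤ T) : ‖x (a + h) - x a - h • f (x a)‖ ≤ L * Λ * h ^ 2 := by
  have hsub : Set.Icc a (a + h) ⊆ Set.Icc 0 T := Set.Icc_subset_Icc ha hah
  have h1 : ∀ s ∈ Set.Icc a (a + h), HasDerivWithinAt (fun s => x s - s • f (x a))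
      (f (x s) - f (x a)) (Set.Icc a (a + h)) s := by
    intro s hs
    have := ((hx s (hsub hs)).mono hsub).fun_sub
      ((hasDerivWithinAt_id s _).smul_const (f (x a)))
    simpa using this
  have h2 : ∀ s ∈ Set.Icc a (a + h), ‖f (x s) - f (x a)‖ ≤ L * (Λ * h) := by
    intro s hs
    refine (hL _ _).trans ?_
    gcongr
    refine (norm_trajectory_sub_le hx hΛ ha hs.1 (hs.2.trans hah)).trans ?_
    gcongr
    linarith [hs.2]
  have h3 := (convex_Icc a (a + h)).norm_image_sub_le_of_norm_hasDerivWithin_le h1 h2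
    (Set.left_mem_Icc.2 (by linarith)) (Set.right_mem_Icc.2 (by linarith))
  have h4 : x (a + h) - (a + h) • f (x a) - (x a - a • f (x a)) =
      x (a + h) - x a - h • f (x a) := by module
  rw [h4, add_sub_cancel_left, Real.norm_of_nonneg hh.le] at h3
  linarith

lemma norm_trajectory_sub_eulerNode_le {Λ : ℝ} (hL0 : 0 ≤ L) (hΛ0 : 0 ≤ Λ)
    (hL : ∀ u v, ‖f u - f v‖ ≤ L * ‖u - v‖)
    (hx : ∀ s ∈ Set.Icc 0 T, HasDerivWithinAt x (f (x s)) (Set.Icc 0 T) s)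
    (hΛ : ∀ s ∈ Set.Icc 0 T, ‖f (x s)‖ ≤ Λ) (hh : 0 < h) {l : ℕ} (hl : l * h ≤ T) :
    ‖x (l * h) - eulerNode f h (x 0) l‖ ≤ Real.exp (L * T) * (T * L * Λ) * h := by
  -- Discrete Gronwall: `l` local errors, each amplified by at most `(1 + h * L) ^ l`.
  have key : ∀ l : ℕ, l * h ≤ T →
      ‖x (l * h) - eulerNode f h (x 0) l‖ ≤ (1 + h * L) ^ l * (l * (L * Λ * h ^ 2)) := by
    intro l
    induction l with
    | zero => simp [eulerNode]
    | succ l ih =>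
      intro hl
      have e : ((l + 1 : ℕ) : ℝ) * h = l * h + h := by
        push_cast
        ring
      rw [e] at hl ⊢
      have h1 := norm_trajectory_sub_eulerStep_le hL0 hΛ0 hL hx hΛ hh (by positivity) hl
      have h2 := ih (by linarith)
      have h3 := mul_le_mul_of_nonneg_left (hL (x (l * h)) (eulerNode f h (x 0) l)) hh.le
      have h4 : x (l * h + h) - eulerNode f h (x 0) (l + 1) =
          (x (l * h + h) - x (l * h) - h • f (x (l * h))) +
          (x (l * h) - eulerNode f h (x 0) l) +
          h • (f (x (l * h)) - f (eulerNode f h (x 0) l)) := by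
        rw [eulerNode]
        module
      rw [h4]
      refine norm_add₃_le.trans ?_
      rw [norm_smul, Real.norm_of_nonneg hh.le]
      have h5 : (1 : ℝ) ≤ (1 + h * L) ^ (l + 1) := one_le_pow₀ (by nlinarith)
      have h6 : 1 * (L * Λ * h ^ 2) ≤ (1 + h * L) ^ (l + 1) * (L * Λ * h ^ 2) := by gcongr
      have h7 := mul_le_mul_of_nonneg_left h2 (by positivity : 0 ≤ 1 + h * L)
      push_cast
      linarith [pow_succ (1 + h * L) l,
        congrArg (· * (l * (L * Λ * h ^ 2))) (pow_succ (1 + h * L) l)]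
  refine (key l hl).trans ?_
  calc (1 + h * L) ^ l * (l * (L * Λ * h ^ 2))
      = (1 + h * L) ^ l * ((l * h) * L * Λ) * h := by ring
    _ ≤ Real.exp (L * T) * (T * L * Λ) * h := by
      have := one_add_mul_pow_le_exp hL0 hh hl
      gcongr

end Flow

/-! ### Riemann sums and summation by parts -/

section Sums

variable {m : ℕ}

lemma sum_integral_fin_adjacent_intervals {E : Type*} [NormedAddCommGroup E] [NormedSpace ℝ E]
    {F : ℝ → E} (t : Fin (m + 1) → ℝ)
    (hF : ∀ i j, IntervalIntegrable F volume (t i) (t j)) :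
    ∑ j : Fin m, ∫ s in t j.castSucc..t j.succ, F s = ∫ s in t 0..t (Fin.last m), F s := by
  induction m with
  | zero => simp
  | succ m ih =>
    rw [Fin.sum_univ_castSucc, Fin.succ_last]
    have := ih (fun i => t i.castSucc) (fun i j => hF _ _)
    simp only [Fin.castSucc_zero, Fin.succ_castSucc] at this ⊢
    rw [this, intervalIntegral.integral_add_adjacent_intervals (hF _ _) (hF _ _)]

/-- A Lipschitz function is integrated by its left Riemann sum up to the sum of squared gaps. -/
lemma integral_le_sum_add_sumSqGaps {F : ℝ → ℝ} {T C : ℝ} {t : Fin (m + 1) → ℝ} (hC : 0 ≤ C)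
    (ht : Monotone t) (h0 : t 0 = 0) (hT : t (Fin.last m) = T)
    (hF : ∀ s ∈ Set.Icc 0 T, ∀ s' ∈ Set.Icc 0 T, s ≤ s' → |F s' - F s| ≤ C * (s' - s)) :
    ∫ s in (0 : ℝ)..T, F s ≤
      ∑ j : Fin m, (t j.succ - t j.castSucc) * F (t j.castSucc) + C * sumSqGaps t := by
  have hmem : ∀ i, t i ∈ Set.Icc 0 T := fun i =>
    ⟨h0 ▸ ht (Fin.zero_le i), hT ▸ ht (Fin.le_last i)⟩
  have hcont : ContinuousOn F (Set.Icc 0 T) := by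
    have : LipschitzOnWith ⟨C, hC⟩ F (Set.Icc 0 T) := by
      refine LipschitzOnWith.of_dist_le_mul fun s hs s' hs' => ?_
      change _ ≤ C * _
      rw [Real.dist_eq, Real.dist_eq]
      rcases le_total s s' with hle | hle
      · rw [abs_sub_comm, abs_sub_comm s, abs_of_nonneg (sub_nonneg.2 hle)]
        exact hF s hs s' hs' hle
      · rw [abs_of_nonneg (sub_nonneg.2 hle)]
        exact hF s' hs' s hs hle
    exact this.continuousOn
  have hint : ∀ i j, IntervalIntegrable F volume (t i) (t j) := fun i j =>
    (hcont.mono (Set.ordConnected_Icc.uIcc_subset (hmem i) (hmem j))).intervalIntegrable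
  rw [← h0, ← hT, ← sum_integral_fin_adjacent_intervals t hint, sumSqGaps, Finset.mul_sum,
    ← Finset.sum_add_distrib]
  refine Finset.sum_le_sum fun j _ => ?_
  have hle : t j.castSucc ≤ t j.succ := ht (Fin.castSucc_le_succ j)
  calc ∫ s in t j.castSucc..t j.succ, F s
      ≤ ∫ s in t j.castSucc..t j.succ,
          (F (t j.castSucc) + C * (t j.succ - t j.castSucc)) := by
        refine intervalIntegral.integral_mono_on hle (hint _ _) intervalIntegrable_const
          fun s hs => ?_
        have hs' : s ∈ Set.Icc 0 T := ⟨(hmem _).1.trans hs.1, hs.2.trans (hmem _).2⟩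
        have h1 := (abs_le.1 (hF _ (hmem j.castSucc) s hs' hs.1)).2
        have h2 : C * (s - t j.castSucc) ≤ C * (t j.succ - t j.castSucc) := by
          gcongr
          exact hs.2
        linarith
    _ = (t j.succ - t j.castSucc) * F (t j.castSucc) + C * (t j.succ - t j.castSucc) ^ 2 := by
        rw [intervalIntegral.integral_const, smul_eq_mul]
        ring

lemma sum_gaps (t : Fin (m + 1) → ℝ) :
    ∑ j : Fin m, (t j.succ - t j.castSucc) = t (Fin.last m) - t 0 := by
  induction m with
  | zero => simp
  | succ m ih =>
    rw [Fin.sum_univ_castSucc, Fin.succ_last]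
    have := ih (fun i => t i.castSucc)
    simp only [Fin.castSucc_zero, Fin.succ_castSucc] at this ⊢
    rw [this]
    ring

lemma sumSqGaps_pos {T : ℝ} {t : Fin (m + 1) → ℝ} (hT : 0 < T) (h0 : t 0 = 0)
    (hlast : t (Fin.last m) = T) : 0 < sumSqGaps t := by
  refine (Finset.sum_nonneg fun j _ => sq_nonneg _).lt_of_ne fun h => ?_
  have h1 := (Finset.sum_eq_zero_iff_of_nonneg fun j _ => sq_nonneg _).1 h.symm
  have h2 := sum_gaps t
  rw [Finset.sum_eq_zero fun j hj => by simpa using h1 j hj] at h2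
  linarith

lemma eq_add_sum_increments {E : Type*} [AddCommGroup E] (G : Fin (m + 1) → E)
    (p : Fin (m + 1)) :
    G p = G 0 + ∑ i : Fin m, if i.castSucc < p then G i.succ - G i.castSucc else 0 := by
  induction p using Fin.induction with
  | zero => simp
  | succ p ih =>
    have h1 : ∀ i : Fin m, (if i.castSucc < p.succ then G i.succ - G i.castSucc else 0) =
        (if i.castSucc < p.castSucc then G i.succ - G i.castSucc else 0) +
        (if i = p then G i.succ - G i.castSucc else 0) := by
      intro i
      rcases lt_trichotomy i p with hi | rfl | hi
      · simp [hi, hi.ne, Fin.castSucc_lt_succ_iff, hi.le]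
      · simp
      · simp [hi.ne', Fin.castSucc_lt_succ_iff, not_le.2 hi, not_lt.2 hi.le]
    simp_rw [h1]
    rw [Finset.sum_add_distrib, ← add_assoc, ← ih]
    simp

/-- Summation by parts: a sequence of bounded increments is tested against vectors `v j` at the
cost of the tail sums of `v`. -/
lemma sum_inner_le_tail_sums {E : Type*} [NormedAddCommGroup E] [InnerProductSpace ℝ E]
    (v : Fin m → E) (G : Fin (m + 1) → E) (b : Option (Fin m) → ℝ) (h0 : ‖G 0‖ ≤ b none)
    (hG : ∀ i : Fin m, ‖G i.succ - G i.castSucc‖ ≤ b (some i)) :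
    ∑ j, inner ℝ (v j) (G j.castSucc) ≤
      ∑ p : Option (Fin m), b p * ‖∑ j, (p.elim 1 fun i => if i < j then (1 : ℝ) else 0) • v j‖ := by
  have h1 : ∀ j, inner ℝ (v j) (G j.castSucc) = inner ℝ (v j) (G 0) +
      ∑ i : Fin m, inner ℝ ((if i < j then (1 : ℝ) else 0) • v j) (G i.succ - G i.castSucc) := by
    intro j
    conv_lhs => rw [eq_add_sum_increments G j.castSucc]
    rw [inner_add_right, inner_sum]
    congr 1
    refine Finset.sum_congr rfl fun i _ => ?_
    by_cases hij : i < j <;> simp [hij]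
  have h2 : ∀ a b : E, ∀ c : ℝ, ‖b‖ ≤ c → inner ℝ a b ≤ c * ‖a‖ := by
    intro a b c hb
    refine (real_inner_le_norm a b).trans ?_
    rw [mul_comm]
    gcongr
  simp_rw [h1]
  rw [Finset.sum_add_distrib, Finset.sum_comm, Fintype.sum_option]
  simp_rw [← sum_inner]
  gcongr with i
  · simpa using h2 _ _ _ h0
  · simpa using h2 _ _ _ (hG i)

end Sums

/-! ### Comparison of losses -/

section LeastSquares

/-- The basic inequality of least squares. -/
lemma sum_sq_le_of_lsLoss_le {d m : ℕ} {t : Fin (m + 1) → ℝ} {k : Fin m → ℕ}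
    {x n : Fin m → Vec d} {z z' : ℕ → Vec d}
    (hle : lsLoss t k (fun j => x j + n j) z ≤ lsLoss t k (fun j => x j + n j) z') :
    ∑ j, (t j.succ - t j.castSucc) * ‖z (k j) - x j‖ ^ 2 ≤
      ∑ j, (t j.succ - t j.castSucc) * ‖x j - z' (k j)‖ ^ 2 +
      2 * ∑ j, inner ℝ ((t j.succ - t j.castSucc) • n j) (z (k j) - z' (k j)) := by
  -- The pure noise term does not depend on `y` and cancels between the two losses.
  have h1 : ∀ y : ℕ → Vec d, lsLoss t k (fun j => x j + n j) y =
      ∑ j, (t j.succ - t j.castSucc) * ‖x j - y (k j)‖ ^ 2 +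
      2 * ∑ j, inner ℝ ((t j.succ - t j.castSucc) • n j) (x j - y (k j)) +
      ∑ j, (t j.succ - t j.castSucc) * ‖n j‖ ^ 2 := by
    intro y
    rw [lsLoss, Finset.mul_sum, ← Finset.sum_add_distrib, ← Finset.sum_add_distrib]
    refine Finset.sum_congr rfl fun j _ => ?_
    rw [show x j + n j - y (k j) = (x j - y (k j)) + n j by abel, norm_add_sq_real,
      real_inner_smul_left, real_inner_comm]
    ring
  rw [h1, h1] at hle
  have h2 : ∑ j, inner ℝ ((t j.succ - t j.castSucc) • n j) (z (k j) - z' (k j)) =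
      ∑ j, inner ℝ ((t j.succ - t j.castSucc) • n j) (x j - z' (k j)) -
      ∑ j, inner ℝ ((t j.succ - t j.castSucc) • n j) (x j - z (k j)) := by
    rw [← Finset.sum_sub_distrib]
    refine Finset.sum_congr rfl fun j _ => ?_
    rw [← inner_sub_right]
    congr 1
    abel
  simp_rw [norm_sub_rev (z _)]
  linarith

end LeastSquares

/-! ### Lipschitz bounds from the kernel -/

section Kernel

variable {d : ℕ} {H : Type*} [NormedAddCommGroup H] [InnerProductSpace ℝ H] [CompleteSpace H]
  [RKHS ℝ H (Vec d) (Vec d)]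

lemma EuclideanSpace.norm_le_sum_abs (v : Vec d) : ‖v‖ ≤ ∑ i, |v i| := by
  rw [EuclideanSpace.norm_eq]
  refine Real.sqrt_le_iff.2 ⟨by positivity, ?_⟩
  simp_rw [Real.norm_eq_abs]
  exact Finset.sum_sq_le_sq_sum_of_nonneg fun i _ => abs_nonneg _

lemma inner_kerFun_single_eq_kernelDiag (i : Fin d) (u v : Vec d) :
    inner ℝ (RKHS.kerFun H u (EuclideanSpace.single i (1 : ℝ)))
      (RKHS.kerFun H v (EuclideanSpace.single i (1 : ℝ))) = kernelDiag (RKHS.kernel H) i u v := by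
  rw [RKHS.kerFun_inner, RKHS.kerFun_apply, kernelDiag, EuclideanSpace.inner_single_left]
  simp

lemma norm_kerFun_single_sub_sq (i : Fin d) (u v : Vec d) :
    ‖RKHS.kerFun H u (EuclideanSpace.single i (1 : ℝ)) -
      RKHS.kerFun H v (EuclideanSpace.single i (1 : ℝ))‖ ^ 2 =
      kernelDiag (RKHS.kernel H) i u u - 2 * kernelDiag (RKHS.kernel H) i u v +
        kernelDiag (RKHS.kernel H) i v v := by
  rw [norm_sub_sq_real, ← real_inner_self_eq_norm_sq, ← real_inner_self_eq_norm_sq,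
    inner_kerFun_single_eq_kernelDiag, inner_kerFun_single_eq_kernelDiag,
    inner_kerFun_single_eq_kernelDiag]

/-- Coordinate `i` of `f u - f v` pairs `f` with a difference of kernel sections, whose squared norm
is the left side of (A4). Summing the coordinates costs the factor `d`. -/
lemma RKHS.norm_sub_le_of_kernelDiag_le {N : ℝ}
    (hN : ∀ (i : Fin d) (u v : Vec d), kernelDiag (RKHS.kernel H) i u u -
      2 * kernelDiag (RKHS.kernel H) i u v + kernelDiag (RKHS.kernel H) i v v ≤
        N ^ 2 * ‖u - v‖ ^ 2) (f : H) (u v : Vec d) :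
    ‖f u - f v‖ ≤ d * (|N| * ‖f‖) * ‖u - v‖ := by
  have h1 : ∀ i, |(f u - f v) i| ≤ |N| * ‖f‖ * ‖u - v‖ := by
    intro i
    have h2 : (f u - f v) i = inner ℝ (RKHS.kerFun H u (EuclideanSpace.single i (1 : ℝ)) -
        RKHS.kerFun H v (EuclideanSpace.single i (1 : ℝ))) f := by
      rw [inner_sub_left, RKHS.kerFun_inner, RKHS.kerFun_inner, EuclideanSpace.inner_single_left,
        EuclideanSpace.inner_single_left]
      simp
    have h3 : ‖RKHS.kerFun H u (EuclideanSpace.single i (1 : ℝ)) -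
        RKHS.kerFun H v (EuclideanSpace.single i (1 : ℝ))‖ ≤ |N| * ‖u - v‖ := by
      refine abs_le_of_sq_le_sq' ?_ (by positivity) |>.2
      rw [norm_kerFun_single_sub_sq, mul_pow, sq_abs]
      exact hN i u v
    rw [h2]
    refine (abs_real_inner_le_norm _ _).trans ?_
    calc _ ≤ |N| * ‖u - v‖ * ‖f‖ := by gcongr
      _ = _ := by ring
  refine (EuclideanSpace.norm_le_sum_abs _).trans ((Finset.sum_le_sum fun i _ => h1 i).trans ?_)
  simp
  linarith

end Kernel

/-! ### Sub-Gaussian tails -/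

section Concentration

variable {Ω : Type*} [MeasurableSpace Ω] {P : Measure Ω} [IsProbabilityMeasure P]

lemma exp_abs_le_exp_add_exp_neg (y : ℝ) : Real.exp |y| ≤ Real.exp y + Real.exp (-y) := by
  rcases abs_cases y with ⟨h, _⟩ | ⟨h, _⟩ <;> rw [h] <;>
    linarith [Real.exp_pos y, Real.exp_pos (-y)]

/-- A nonnegative combination of absolute values of (dependent) sub-Gaussian variables has a
Gaussian tail. -/
lemma measureReal_le_sum_mul_abs_le {ι : Type*} [Fintype ι] {b : ι → ℝ} {X : ι → Ω → ℝ}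
    {c : NNReal} {S u : ℝ} (hb : ∀ p, 0 ≤ b p) (hS : ∑ p, b p = S) (hS0 : 0 < S)
    (hc : 0 < c) (hX : ∀ p, HasSubgaussianMGF (X p) c P) (hu : 0 ≤ u) :
    P.real {ω | u ≤ ∑ p, b p * |X p ω|} ≤ 2 * Real.exp (-u ^ 2 / (2 * c * S ^ 2)) := by
  have hc' : (0 : ℝ) < c := hc
  -- The Chernoff parameter minimizing `c * lam ^ 2 / 2 - lam * u / S`.
  obtain ⟨lam, hlam⟩ : ∃ lam : ℝ, lam = u / (c * S) := ⟨_, rfl⟩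
  have hlam0 : 0 ≤ lam := by rw [hlam]; positivity
  have hint : ∀ p, Integrable (fun ω => b p / S *
      (Real.exp (lam * X p ω) + Real.exp (-lam * X p ω))) P := fun p =>
    (((hX p).integrable_exp_mul lam).add ((hX p).integrable_exp_mul (-lam))).const_mul _
  have hw : ∑ p, b p / S = 1 := by rw [← Finset.sum_div, hS, div_self hS0.ne']
  have h1 : ∫ ω, ∑ p, b p / S * (Real.exp (lam * X p ω) + Real.exp (-lam * X p ω)) ∂P ≤
      2 * Real.exp (c * lam ^ 2 / 2) := by
    rw [integral_finsetSum _ fun p _ => hint p]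
    calc _ ≤ ∑ p, b p / S * (2 * Real.exp (c * lam ^ 2 / 2)) := by
          refine Finset.sum_le_sum fun p _ => ?_
          rw [integral_const_mul, integral_add ((hX p).integrable_exp_mul lam)
            ((hX p).integrable_exp_mul (-lam))]
          have e1 := (hX p).mgf_le lam
          have e2 := (hX p).mgf_le (-lam)
          rw [neg_sq] at e2
          refine mul_le_mul_of_nonneg_left ?_ (div_nonneg (hb p) hS0.le)
          rw [mgf] at e1 e2
          linarith
      _ = _ := by rw [← Finset.sum_mul, hw, one_mul]
  have h2 := mul_meas_ge_le_integral_of_nonneg (μ := P)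
    (f := fun ω => ∑ p, b p / S * (Real.exp (lam * X p ω) + Real.exp (-lam * X p ω)))
    (ae_of_all _ fun ω => Finset.sum_nonneg fun p _ =>
      mul_nonneg (div_nonneg (hb p) hS0.le) (by positivity))
    (integrable_finsetSum _ fun p _ => hint p) (Real.exp (lam * (u / S)))
  have h3 : {ω | u ≤ ∑ p, b p * |X p ω|} ⊆ {ω | Real.exp (lam * (u / S)) ≤
      ∑ p, b p / S * (Real.exp (lam * X p ω) + Real.exp (-lam * X p ω))} := by
    intro ω hω
    simp only [Set.mem_ofPred_eq] at hω ⊢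
    calc Real.exp (lam * (u / S)) ≤ Real.exp (∑ p, b p / S * |lam * X p ω|) := by
          rw [Real.exp_le_exp]
          calc lam * (u / S) ≤ lam * ((∑ p, b p * |X p ω|) / S) := by gcongr
            _ = _ := by
              rw [Finset.sum_div, Finset.mul_sum]
              refine Finset.sum_congr rfl fun p _ => ?_
              rw [abs_mul, abs_of_nonneg hlam0]
              ring
      -- Jensen with weights `b p / S`; no independence between the `X p` is used.
      _ ≤ ∑ p, b p / S * Real.exp |lam * X p ω| := by
          simpa using convexOn_exp.map_sum_le (t := Finset.univ) (w := fun p => b p / S)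
            (p := fun p => |lam * X p ω|) (fun p _ => div_nonneg (hb p) hS0.le) hw
            (fun p _ => Set.mem_univ _)
      _ ≤ _ := by
          refine Finset.sum_le_sum fun p _ =>
            mul_le_mul_of_nonneg_left ?_ (div_nonneg (hb p) hS0.le)
          simpa using exp_abs_le_exp_add_exp_neg (lam * X p ω)
  have h4 : Real.exp (lam * (u / S)) * P.real {ω | u ≤ ∑ p, b p * |X p ω|} ≤
      2 * Real.exp (c * lam ^ 2 / 2) := by
    refine le_trans ?_ (h2.trans h1)
    gcongr
    exact measure_ne_top _ _
  rw [mul_comm, ← le_div_iff₀ (Real.exp_pos _)] at h4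
  refine h4.trans (le_of_eq ?_)
  rw [mul_div_assoc, ← Real.exp_sub, hlam]
  congr 2
  field_simp
  ring

variable {d m : ℕ} {noise : Fin m → Ω → Vec d}

/-- Hoeffding's lemma on `[-w j * M, w j * M]`. Using `w j` in place of `|a j|` gives all tail sums
the same variance proxy. -/
lemma hasSubgaussianMGF_sum_mul_coord {M V : ℝ} {w a : Fin m → ℝ} {c : NNReal}
    (hmeas : ∀ j, Measurable (noise j)) (hind : iIndepFun noise P)
    (hmean : ∀ j, ∫ ω, noise j ω ∂P = 0) (hbdd : ∀ j, ∀ᵐ ω ∂P, ‖noise j ω‖ ≤ M)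
    (haw : ∀ j, |a j| ≤ w j) (hV : ∑ j, w j ^ 2 = V) (hc : (c : ℝ) = M ^ 2 * V) (i : Fin d) :
    HasSubgaussianMGF (fun ω => ∑ j, a j * noise j ω i) c P := by
  have hcoord : ∀ j, Measurable fun ω => noise j ω i := fun j => by
    have := hmeas j
    fun_prop
  have h1 : ∀ j, HasSubgaussianMGF (fun ω => a j * noise j ω i)
      ((‖w j * M - -(w j * M)‖₊ / 2) ^ 2) P := by
    intro j
    refine hasSubgaussianMGF_of_mem_Icc_of_integral_eq_zero
      ((hcoord j).const_mul _).aemeasurable ?_ ?_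
    · filter_upwards [hbdd j] with ω hω
      rw [Set.mem_Icc, ← abs_le, abs_mul]
      have h2 : |noise j ω i| ≤ M := (PiLp.norm_apply_le (noise j ω) i).trans hω
      exact mul_le_mul (haw j) h2 (abs_nonneg _) ((abs_nonneg _).trans (haw j))
    · rw [integral_const_mul]
      have hint : Integrable (noise j) P :=
        Integrable.of_bound (hmeas j).aestronglyMeasurable M (hbdd j)
      have := (EuclideanSpace.proj (𝕜 := ℝ) i : Vec d →L[ℝ] ℝ).integral_comp_comm hint
      rw [hmean j] at this
      simp at this
      simp [this]
  have hind' : iIndepFun (fun j ω => a j * noise j ω i) P :=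
    hind.comp (fun j (v : Vec d) => a j * v i) fun j => by fun_prop
  have h2 := HasSubgaussianMGF.sum_of_iIndepFun hind' (s := Finset.univ) fun j _ => h1 j
  convert h2
  apply NNReal.coe_injective
  rw [hc, ← hV, NNReal.coe_sum, Finset.mul_sum]
  refine Finset.sum_congr rfl fun j _ => ?_
  push_cast
  rw [sub_neg_eq_add, ← two_mul, Real.norm_eq_abs, abs_mul, abs_two, mul_div_cancel_left₀ _
    two_ne_zero, sq_abs]
  ring

end Concentration

/-! ### Deterministic error bound and noise tail -/

section Assembly

/-- Coefficients of the tail sums in the summation by parts: `none` stands for the full sum. -/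
def tailCoeff {m : ℕ} (p : Option (Fin m)) (j : Fin m) : ℝ :=
  p.elim 1 fun i => if i < j then 1 else 0

/-- Weights of the tail sums in the summation by parts, for a sequence that starts in the ball of
radius `ρ` and moves with speed at most `Λ`. -/
def tailWeight {m : ℕ} (t : Fin (m + 1) → ℝ) (ρ Λ : ℝ) (p : Option (Fin m)) : ℝ :=
  p.elim ρ fun i => Λ * (t i.succ - t i.castSucc)

lemma abs_tailCoeff_le {m : ℕ} (p : Option (Fin m)) (j : Fin m) : |tailCoeff p j| ≤ 1 := by
  rcases p with _ | i
  · simp [tailCoeff]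
  · by_cases h : i < j <;> simp [tailCoeff, h]

lemma tailWeight_nonneg {m : ℕ} {t : Fin (m + 1) → ℝ} (ht : Monotone t) {ρ Λ : ℝ} (hρ : 0 ≤ ρ)
    (hΛ : 0 ≤ Λ) (p : Option (Fin m)) : 0 ≤ tailWeight t ρ Λ p := by
  rcases p with _ | i
  · exact hρ
  · exact mul_nonneg hΛ (sub_nonneg.2 (ht (Fin.castSucc_le_succ i)))

lemma sum_tailWeight {m : ℕ} (t : Fin (m + 1) → ℝ) (ρ Λ : ℝ) :
    ∑ p, tailWeight t ρ Λ p = ρ + Λ * (t (Fin.last m) - t 0) := by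
  rw [Fintype.sum_option, ← sum_gaps, Finset.mul_sum]
  rfl

/-- The deterministic error bound: the squared `L²` error of the least squares estimator is
controlled by the discretization error and by tail sums of the noise. -/
lemma integral_sq_error_le {d m : ℕ} {f g : Vec d → Vec d} {L A T ρ h D Λ : ℝ}
    {x : ℝ → Vec d} {z₀ : Vec d} {t : Fin (m + 1) → ℝ} {k : Fin m → ℕ} {n : Fin m → Vec d}
    (h1 : 1 ≤ L) (hA : 0 ≤ A) (hT : 0 < T) (hD : D = Real.exp (L * T) * (ρ + A))
    (hΛ : Λ = L * D)
    (hf : ∀ u v, ‖f u - f v‖ ≤ L * ‖u - v‖) (hf0 : ‖f 0‖ ≤ A)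
    (hg : ∀ u v, ‖g u - g v‖ ≤ L * ‖u - v‖) (hg0 : ‖g 0‖ ≤ A)
    (hz : ‖z₀‖ ≤ ρ) (hx0 : ‖x 0‖ ≤ ρ)
    (hx : ∀ s ∈ Set.Icc 0 T, HasDerivWithinAt x (g (x s)) (Set.Icc 0 T) s)
    (hh : 0 < h) (ht0 : t 0 = 0) (htT : t (Fin.last m) = T) (ht : Monotone t)
    (htk : ∀ j : Fin m, t j.castSucc = k j * h)
    (hloss : lsLoss t k (fun j => x (t j.castSucc) + n j) (eulerNode f h z₀) ≤
      lsLoss t k (fun j => x (t j.castSucc) + n j) (eulerNode g h (x 0))) :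
    ∫ s in (0 : ℝ)..T, ‖eulerPath f h z₀ s - x s‖ ^ 2 ≤
      T * (Real.exp (L * T) * (T * L * Λ)) ^ 2 * h ^ 2 + 8 * (D + Λ * T) * Λ * sumSqGaps t +
      2 * ∑ p, tailWeight t (2 * ρ) (2 * Λ) p *
        ‖∑ j, (tailCoeff p j * (t j.succ - t j.castSucc)) • n j‖ := by
  have hfa := norm_le_affine_of_lipschitz hf hf0
  have hga := norm_le_affine_of_lipschitz hg hg0
  have hρ : 0 ≤ ρ := (norm_nonneg _).trans hz
  have hD0 : 0 ≤ D := by rw [hD]; positivity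
  have hL0 : 0 ≤ L := by linarith
  have hΛ0 : 0 ≤ Λ := by rw [hΛ]; positivity
  have hgap : ∀ j : Fin m, 0 ≤ t j.succ - t j.castSucc := fun j =>
    sub_nonneg.2 (ht (Fin.castSucc_le_succ j))
  have hmem : ∀ i, t i ∈ Set.Icc 0 T := fun i =>
    ⟨ht0 ▸ ht (Fin.zero_le i), htT ▸ ht (Fin.le_last i)⟩
  have hkT : ∀ j, (k j : ℝ) * h ≤ T := fun j => htk j ▸ (hmem j.castSucc).2
  have hfn : ∀ l : ℕ, l * h ≤ T → ‖eulerNode f h z₀ l‖ + A ≤ D := fun l hl =>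
    hD ▸ norm_eulerNode_add_le h1 hA hfa hh hz hl
  have hgn : ∀ l : ℕ, l * h ≤ T → ‖eulerNode g h (x 0) l‖ + A ≤ D := fun l hl =>
    hD ▸ norm_eulerNode_add_le h1 hA hga hh hx0 hl
  have hxn : ∀ s ∈ Set.Icc 0 T, ‖x s‖ + A ≤ D := fun s hs =>
    hD ▸ norm_trajectory_add_le h1 hA hga hx hx0 hs
  have hfΛ : ∀ l : ℕ, l * h ≤ T → ‖f (eulerNode f h z₀ l)‖ ≤ Λ := fun l hl =>
    hΛ ▸ norm_field_le_of_norm_add_le h1 hA hfa (hfn l hl)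
  have hgΛ : ∀ l : ℕ, l * h ≤ T → ‖g (eulerNode g h (x 0) l)‖ ≤ Λ := fun l hl =>
    hΛ ▸ norm_field_le_of_norm_add_le h1 hA hga (hgn l hl)
  have hxΛ : ∀ s ∈ Set.Icc 0 T, ‖g (x s)‖ ≤ Λ := fun s hs =>
    hΛ ▸ norm_field_le_of_norm_add_le h1 hA hga (hxn s hs)
  have hpath0 : ∀ (φ : Vec d → Vec d) (y : Vec d), eulerPath φ h y 0 = y := fun φ y => by
    simpa [eulerNode] using eulerPath_natCast_mul (f := φ) (z₀ := y) hh 0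
  -- The right node of the last cell may lie beyond `T`, outside the control by `D`; the bound
  -- therefore uses the speed from time `0`.
  have hpathD : ∀ s ∈ Set.Icc 0 T, ‖eulerPath f h z₀ s‖ ≤ D + Λ * T := by
    intro s hs
    have e1 := norm_eulerPath_sub_le hh hfΛ le_rfl hs.1 hs.2
    rw [hpath0, sub_zero] at e1
    have e2 := norm_le_insert' (eulerPath f h z₀ s) z₀
    have e3 := hfn 0 (by simpa using hT.le)
    rw [eulerNode] at e3
    have e4 : Λ * s ≤ Λ * T := by
      gcongr
      exact hs.2
    linarith
  have hLip : ∀ s ∈ Set.Icc 0 T, ∀ s' ∈ Set.Icc 0 T, s ≤ s' →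
      |‖eulerPath f h z₀ s' - x s'‖ ^ 2 - ‖eulerPath f h z₀ s - x s‖ ^ 2| ≤
        8 * (D + Λ * T) * Λ * (s' - s) := by
    intro s hs s' hs' hss
    have e1 := norm_eulerPath_sub_le hh hfΛ hs.1 hss hs'.2
    have e2 := norm_trajectory_sub_le hx hxΛ hs.1 hss hs'.2
    have e3 : |‖eulerPath f h z₀ s' - x s'‖ - ‖eulerPath f h z₀ s - x s‖| ≤
        2 * Λ * (s' - s) := by
      refine (abs_norm_sub_norm_le _ _).trans ?_
      rw [sub_sub_sub_comm]
      refine (norm_sub_le _ _).trans ?_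
      linarith
    have e4 : ∀ r ∈ Set.Icc 0 T, ‖eulerPath f h z₀ r - x r‖ ≤ 2 * (D + Λ * T) := fun r hr => by
      have := norm_sub_le (eulerPath f h z₀ r) (x r)
      have : 0 ≤ Λ * T := by positivity
      linarith [hpathD r hr, hxn r hr]
    rw [sq_sub_sq, abs_mul, abs_of_nonneg (by positivity)]
    calc _ ≤ (2 * (D + Λ * T) + 2 * (D + Λ * T)) * (2 * Λ * (s' - s)) := by
          gcongr
          exacts [e4 _ hs', e4 _ hs]
      _ = _ := by ring
  have hriem := integral_le_sum_add_sumSqGaps (by positivity) ht ht0 htT hLip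
  have hpathk : ∀ (φ : Vec d → Vec d) (y : Vec d) (j : Fin m),
      eulerPath φ h y (t j.castSucc) = eulerNode φ h y (k j) := fun φ y j => by
    rw [htk, eulerPath_natCast_mul hh]
  have hbasic := sum_sq_le_of_lsLoss_le hloss
  have hdisc : ∑ j, (t j.succ - t j.castSucc) *
      ‖x (t j.castSucc) - eulerNode g h (x 0) (k j)‖ ^ 2 ≤
      T * (Real.exp (L * T) * (T * L * Λ)) ^ 2 * h ^ 2 := by
    calc _ ≤ ∑ j : Fin m, (t j.succ - t j.castSucc) *
          (Real.exp (L * T) * (T * L * Λ) * h) ^ 2 := by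
          refine Finset.sum_le_sum fun j _ => mul_le_mul_of_nonneg_left ?_ (hgap j)
          gcongr
          rw [htk]
          exact norm_trajectory_sub_eulerNode_le hL0 hΛ0 hg hx hxΛ hh (hkT j)
      _ = _ := by
          rw [← Finset.sum_mul, sum_gaps, htT, ht0]
          ring
  -- Both paths are Euler paths, so their difference starts within `2 * ρ` and has speed at most `2
  -- * Λ`, whatever the noise.
  have hnoise := sum_inner_le_tail_sums (fun j => (t j.succ - t j.castSucc) • n j)
    (fun i => eulerPath f h z₀ (t i) - eulerPath g h (x 0) (t i)) (tailWeight t (2 * ρ) (2 * Λ))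
    (by
      rw [ht0, hpath0, hpath0]
      refine (norm_sub_le _ _).trans ?_
      rw [tailWeight, Option.elim_none]
      linarith)
    (fun i => by
      have e0 : t i.castSucc ≤ t i.succ := ht (Fin.castSucc_le_succ i)
      have e1 := norm_eulerPath_sub_le hh hfΛ (hmem i.castSucc).1 e0 (hmem i.succ).2
      have e2 := norm_eulerPath_sub_le hh hgΛ (hmem i.castSucc).1 e0 (hmem i.succ).2
      rw [sub_sub_sub_comm]
      refine (norm_sub_le _ _).trans ?_
      rw [tailWeight, Option.elim_some]
      linarith)
  simp only [hpathk, smul_smul] at hnoise hriem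
  change _ ≤ ∑ p, tailWeight t (2 * ρ) (2 * Λ) p *
        ‖∑ j, (tailCoeff p j * (t j.succ - t j.castSucc)) • n j‖ at hnoise
  linarith

/-- Tail bound for the noise functional of the deterministic error bound. -/
lemma measureReal_le_sum_tailWeight_mul_norm_le {Ω : Type*} [MeasurableSpace Ω] {P : Measure Ω}
    [IsProbabilityMeasure P] {d m : ℕ} {noise : Fin m → Ω → Vec d} {M T ρ Λ u : ℝ}
    {t : Fin (m + 1) → ℝ} (hd : 0 < d) (hM : 0 < M) (hT : 0 < T) (hρ : 0 < ρ) (hΛ : 0 ≤ Λ)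
    (ht0 : t 0 = 0) (htT : t (Fin.last m) = T) (ht : Monotone t)
    (hmeas : ∀ j, Measurable (noise j)) (hind : iIndepFun noise P)
    (hmean : ∀ j, ∫ ω, noise j ω ∂P = 0) (hbdd : ∀ j, ∀ᵐ ω ∂P, ‖noise j ω‖ ≤ M) (hu : 0 ≤ u) :
    P.real {ω | u ≤ ∑ p, tailWeight t ρ Λ p *
        ‖∑ j, (tailCoeff p j * (t j.succ - t j.castSucc)) • noise j ω‖} ≤
      2 * Real.exp (-u ^ 2 / (2 * (M ^ 2 * sumSqGaps t) * (d * (ρ + Λ * T)) ^ 2)) := by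
  have hV := sumSqGaps_pos hT ht0 htT
  obtain ⟨c, hc⟩ : ∃ c : NNReal, (c : ℝ) = M ^ 2 * sumSqGaps t :=
    ⟨⟨M ^ 2 * sumSqGaps t, by positivity⟩, rfl⟩
  have hc0 : 0 < c := by
    rw [← NNReal.coe_pos, hc]
    positivity
  -- Norms are bounded by sums of absolute coordinates, so pairs of a tail and a coordinate are the
  -- index set; this multiplies the total weight by `d`.
  have hX : ∀ q : Option (Fin m) × Fin d, HasSubgaussianMGF
      (fun ω => ∑ j, tailCoeff q.1 j * (t j.succ - t j.castSucc) * noise j ω q.2) c P := fun q =>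
    hasSubgaussianMGF_sum_mul_coord (w := fun j => t j.succ - t j.castSucc) hmeas hind hmean hbdd
      (fun j => by
        have e0 : t j.castSucc ≤ t j.succ := ht (Fin.castSucc_le_succ j)
        rw [abs_mul, abs_of_nonneg (sub_nonneg.2 e0)]
        exact mul_le_of_le_one_left (sub_nonneg.2 e0) (abs_tailCoeff_le _ _)) rfl hc q.2
  have hsum : ∑ q : Option (Fin m) × Fin d, tailWeight t ρ Λ q.1 = d * (ρ + Λ * T) := by
    rw [Fintype.sum_prod_type]
    simp only [Finset.sum_const, Finset.card_univ, Fintype.card_fin, nsmul_eq_mul]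
    rw [← Finset.mul_sum, sum_tailWeight, htT, ht0, sub_zero]
  have hd' : (0 : ℝ) < d := by exact_mod_cast hd
  have := measureReal_le_sum_mul_abs_le (fun q => tailWeight_nonneg ht hρ.le hΛ q.1) hsum
    (by positivity) hc0 hX hu
  rw [hc] at this
  refine le_trans ?_ this
  refine measureReal_mono ?_ (measure_ne_top _ _)
  intro ω hω
  simp only [Set.mem_ofPred_eq] at hω ⊢
  refine hω.trans ?_
  rw [Fintype.sum_prod_type]
  refine Finset.sum_le_sum fun p _ => ?_
  simp only
  rw [← Finset.mul_sum]
  refine mul_le_mul_of_nonneg_left ((EuclideanSpace.norm_le_sum_abs _).trans (le_of_eq ?_))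
    (tailWeight_nonneg ht hρ.le hΛ p)
  refine Finset.sum_congr rfl fun i _ => ?_
  simp

end Assembly

/-! ### Choice of constants and conclusion -/

theorem theorem1 (d : ℕ) (K : Matrix (Vec d) (Vec d) (Vec d →L[ℝ] Vec d))
    (R r T M N B : ℝ) (hT : 0 < T)
    -- the kernel is `C²` in its first argument
    (hK : ∀ v : Vec d, ContDiff ℝ 2 (fun u : Vec d => K u v))
    -- the Lipschitz condition on the kernel
    (hN : ∀ (i : Fin d) (u v : Vec d),
      kernelDiag K i u u - 2 * kernelDiag K i u v + kernelDiag K i v v ≤ N ^ 2 * ‖u - v‖ ^ 2) :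
    ∃ K₁ K₂ K₃ K₄ : ℝ, 0 < K₁ ∧ 0 < K₂ ∧ 0 < K₃ ∧ 0 < K₄ ∧
      -- the RKHS with kernel `K`, and the centre of the ball
      ∀ (H : Type*) [NormedAddCommGroup H] [InnerProductSpace ℝ H] [CompleteSpace H]
        [RKHS ℝ H (Vec d) (Vec d)], RKHS.kernel H = K →
      ∀ f₀ : H, ‖f₀‖ ≤ B →
      -- the true trajectory, generated by a vector field in the ball
      ∀ (fstar : H) (xstar : ℝ → Vec d), ‖fstar - f₀‖ ≤ R → ‖xstar 0‖ ≤ r →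
        (∀ s ∈ Set.Icc 0 T, HasDerivWithinAt xstar (fstar (xstar s)) (Set.Icc 0 T) s) →
      -- observation times `0 = t_1 < ... < t_m ≤ t_{m+1} = T` with `t_j = k_j h`
      ∀ (m : ℕ) (t : Fin (m + 1) → ℝ) (h : ℝ) (k : Fin m → ℕ), 0 < h →
        t 0 = 0 → t (Fin.last m) = T → Monotone t → StrictMono (fun j : Fin m => t j.castSucc) →
        (∀ j : Fin m, t j.castSucc = k j * h) →
      -- independent, centred, bounded noise
      ∀ (Ω : Type*) [MeasurableSpace Ω] (P : Measure Ω) [IsProbabilityMeasure P]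
        (noise : Fin m → Ω → Vec d), (∀ j, Measurable (noise j)) → iIndepFun noise P →
        (∀ j, ∫ ω, noise j ω ∂P = 0) → (∀ j, ∀ᵐ ω ∂P, ‖noise j ω‖ ≤ M) →
      -- the least squares estimator computed from `y_j = xstar(t_j) + noise_j`
      ∀ (fhat : Ω → H) (zhat : Ω → Vec d),
        (∀ ω, IsLeastSquares f₀ R r h t k (fun j => xstar (t j.castSucc) + noise j ω)
          (fhat ω) (zhat ω)) →
      ∀ ε : ℝ, 0 < ε →
        P.real {ω | K₁ * d * √(sumSqGaps t) + K₃ * d * h ^ 2 + K₄ * d * sumSqGaps t + ε ≤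
            ∫ s in (0 : ℝ)..T, ‖eulerPath (fhat ω) h (zhat ω) s - xstar s‖ ^ 2} <
          Real.exp (-(K₂ * ε ^ 2) / (d * sumSqGaps t)) := by
  -- For `d = 0` the error vanishes, so the event is empty, and the right side is `exp 0` because
  -- division by zero gives `0`.
  rcases Nat.eq_zero_or_pos d with rfl | hd
  · refine ⟨1, 1, 1, 1, one_pos, one_pos, one_pos, one_pos, ?_⟩
    intro H _ _ _ _ _ f₀ _ fstar xstar _ _ _ m t h k _ _ _ _ _ _ Ω _ P _ noise _ _ _ _
      fhat zhat _ ε hε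
    have h1 : ∀ v : Vec 0, ‖v‖ = 0 := fun v => by simp [EuclideanSpace.norm_eq]
    simp [h1, not_le.2 hε]
  have hd1 : (1 : ℝ) ≤ d := by exact_mod_cast hd
  have hd0 : (0 : ℝ) < d := by linarith
  obtain ⟨L, hLdef⟩ : ∃ L : ℝ, L = d * (|N| * (|B| + |R|)) + 1 := ⟨_, rfl⟩
  obtain ⟨A, hAdef⟩ : ∃ A : ℝ, A = (|B| + |R|) * √‖K 0 0‖ := ⟨_, rfl⟩
  obtain ⟨ρ, hρdef⟩ : ∃ ρ : ℝ, ρ = |r| + 1 := ⟨_, rfl⟩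
  obtain ⟨D, hD⟩ : ∃ D : ℝ, D = Real.exp (L * T) * (ρ + A) := ⟨_, rfl⟩
  obtain ⟨Λ, hΛ⟩ : ∃ Λ : ℝ, Λ = L * D := ⟨_, rfl⟩
  obtain ⟨M', hM'⟩ : ∃ M' : ℝ, M' = |M| + 1 := ⟨_, rfl⟩
  obtain ⟨S, hS⟩ : ∃ S : ℝ, S = d * (2 * ρ + 2 * Λ * T) := ⟨_, rfl⟩
  have hL1 : 1 ≤ L := by
    rw [hLdef]
    have : 0 ≤ d * (|N| * (|B| + |R|)) := by positivity
    linarith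
  have hL0 : 0 < L := by linarith
  have hA : 0 ≤ A := by rw [hAdef]; positivity
  have hρ : 0 < ρ := by rw [hρdef]; positivity
  have hD0 : 0 < D := by rw [hD]; positivity
  have hΛ0 : 0 < Λ := by rw [hΛ]; positivity
  have hM0 : 0 < M' := by rw [hM']; positivity
  have hS0 : 0 < S := by rw [hS]; positivity
  -- With `u = (4 * M' * S * √V + ε) / 2` and `V = sumSqGaps t`, the exponent `-u ^ 2 / (2 * M' ^ 2
  -- * V * S ^ 2)` is at most `-2 - ε ^ 2 / (8 * M' ^ 2 * S ^ 2 * V)`. The `-2` absorbs the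
  -- prefactor `2` of the tail bound and makes the inequality strict.
  refine ⟨4 * M' * S, 1 / (8 * M' ^ 2 * S ^ 2),
    T * (Real.exp (L * T) * (T * L * Λ)) ^ 2, 8 * (D + Λ * T) * Λ,
    by positivity, by positivity, by positivity, by positivity, ?_⟩
  intro H _ _ _ _ hker f₀ hf₀ fstar xstar hfstar hx0 hx m t h k hh ht0 htT ht _ htk Ω _ P _
    noise hmeas hind hmean hbdd fhat zhat hls ε hε
  have hball : ∀ f : H, ‖f - f₀‖ ≤ R → ‖f‖ ≤ |B| + |R| := fun f hf => by
    have := norm_le_insert' f f₀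
    linarith [le_abs_self B, le_abs_self R]
  have hlip : ∀ f : H, ‖f - f₀‖ ≤ R → ∀ u v, ‖f u - f v‖ ≤ L * ‖u - v‖ := fun f hf u v => by
    refine (RKHS.norm_sub_le_of_kernelDiag_le (hker ▸ hN) f u v).trans ?_
    rw [hLdef]
    gcongr
    refine le_trans ?_ (le_add_of_nonneg_right zero_le_one)
    gcongr
    exact hball f hf
  have hzero : ∀ f : H, ‖f - f₀‖ ≤ R → ‖f 0‖ ≤ A := fun f hf => by
    refine (RKHS.norm_apply_le f 0).trans ?_
    rw [hAdef, hker]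
    gcongr
    exact hball f hf
  have hr : r ≤ ρ := by linarith [le_abs_self r]
  have hV := sumSqGaps_pos hT ht0 htT
  obtain ⟨V, hVdef⟩ : ∃ V, V = sumSqGaps t := ⟨_, rfl⟩
  have hdet := fun ω => integral_sq_error_le (n := fun j => noise j ω) hL1 hA hT hD hΛ
    (hlip _ (hls ω).norm_sub_le) (hzero _ (hls ω).norm_sub_le) (hlip _ hfstar) (hzero _ hfstar)
    ((hls ω).norm_init_le.trans hr) (hx0.trans hr) hx hh ht0 htT ht htk
    ((hls ω).loss_le fstar (xstar 0) hfstar hx0)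
  have htail := measureReal_le_sum_tailWeight_mul_norm_le (u := (4 * M' * S * √V + ε) / 2) hd hM0
    hT (by positivity : 0 < 2 * ρ) (by positivity : 0 ≤ 2 * Λ) ht0 htT ht hmeas hind hmean
    (fun j => (hbdd j).mono fun ω hω => hω.trans (by linarith [le_abs_self M])) (by positivity)
  rw [← hS] at htail
  simp only [← hVdef] at hdet htail hV ⊢
  -- The constants already contain the dependence on `d`; the explicit factors `d` only weaken the
  -- bound.
  have hle : ∀ y : ℝ, 0 ≤ y → y ≤ d * y := fun y hy => le_mul_of_one_le_left hy hd1
  calc _ ≤ P.real {ω | (4 * M' * S * √V + ε) / 2 ≤ ∑ p, tailWeight t (2 * ρ) (2 * Λ) p *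
        ‖∑ j, (tailCoeff p j * (t j.succ - t j.castSucc)) • noise j ω‖} := by
        refine measureReal_mono ?_ (measure_ne_top _ _)
        intro ω hω
        simp only [Set.mem_ofPred_eq] at hω ⊢
        have e1 := hle (4 * M' * S * √V) (by positivity)
        have e2 := hle (T * (Real.exp (L * T) * (T * L * Λ)) ^ 2 * h ^ 2) (by positivity)
        have e3 := hle (8 * (D + Λ * T) * Λ * V) (by positivity)
        linarith [hdet ω]
    _ ≤ _ := htail
    _ ≤ 2 * Real.exp (-2 - 1 / (8 * M' ^ 2 * S ^ 2) * ε ^ 2 / V) := by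
        gcongr
        have e1 : (4 * M' * S * √V) ^ 2 + ε ^ 2 ≤ (4 * M' * S * √V + ε) ^ 2 := by
          have : 0 ≤ 4 * M' * S * √V * ε := by positivity
          linarith
        have e2 : (4 * M' * S * √V) ^ 2 = 16 * M' ^ 2 * S ^ 2 * V := by
          rw [mul_pow, Real.sq_sqrt hV.le]
          ring
        rw [e2] at e1
        have e3 : -2 - 1 / (8 * M' ^ 2 * S ^ 2) * ε ^ 2 / V =
            -((16 * M' ^ 2 * S ^ 2 * V + ε ^ 2) / 4) / (2 * (M' ^ 2 * V) * S ^ 2) := by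
          field_simp
          ring
        rw [e3]
        gcongr
        linarith
    _ < Real.exp (-(1 / (8 * M' ^ 2 * S ^ 2) * ε ^ 2 / V)) := by
        rw [sub_eq_add_neg, Real.exp_add, ← mul_assoc]
        refine mul_lt_of_lt_one_left (Real.exp_pos _) ?_
        rw [Real.exp_neg, ← div_eq_mul_inv, div_lt_one (Real.exp_pos _)]
        linarith [Real.add_one_le_exp (2 : ℝ)]
    _ ≤ _ := by
        rw [neg_div]
        gcongr
        exact hle V hV.le
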